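/- A GF(2)-grammar over a finite alphabet $\Sigma$ is an ordinary context-free grammar $G$ (finitely many nonterminals, an initial nonterminal $S$, and a finite set of rules $A \to X_1 \cdots X_\ell$ with $\ell \geqslant 0$ and each $X_i$ a terminal or a nonterminal) such that every string $w \in \Sigma^*$ has only finitely many parse trees with root $S$. The language described by such a grammar is the set of all strings $w \in \Sigma^*$ for which the number of parse trees of $w$ with root $S$ is odd. **Theorem.** Let $a \neq b$ be two symbols of an alphabet. Then the language $\{\, a^{2^n} b^{2^n} \mid n \in \mathbb{N},\ n \geqslant 0 \,\}$ is not described by any GF(2)-grammar. -/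

import Mathlib

/-- Ordered parse forests of a context-free grammar `G` over a sentential form `X₁ … X_ℓ`: for every
terminal `X_i` the forest has a leaf, and for every nonterminal `X_i = A` it has a parse tree with
root `A`, given by a rule `A → γ` of `G` together with the forest over `γ` of the root's subtrees. -/
inductive ContextFreeGrammar.ParseForest {T : Type*} (G : ContextFreeGrammar T) :
    List (Symbol T G.NT) → Type _
  | nil : ContextFreeGrammar.ParseForest G []
  | leaf (t : T) {α : List (Symbol T G.NT)} (rest : ContextFreeGrammar.ParseForest G α) :
      ContextFreeGrammar.ParseForest G (Symbol.terminal t :: α)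
  | node (A : G.NT) (γ : List (Symbol T G.NT)) (rule_mem : ContextFreeRule.mk A γ ∈ G.rules)
      (children : ContextFreeGrammar.ParseForest G γ)
      {α : List (Symbol T G.NT)} (rest : ContextFreeGrammar.ParseForest G α) :
      ContextFreeGrammar.ParseForest G (Symbol.nonterminal A :: α)

/-- The string of terminals at the leaves of a parse forest, read from left to right. -/
def ContextFreeGrammar.ParseForest.yield {T : Type*} {G : ContextFreeGrammar T} :
    {α : List (Symbol T G.NT)} → G.ParseForest α → List T
  | _, .nil => []
  | _, .leaf t rest => t :: rest.yield
  | _, .node _ _ _ children rest => children.yield ++ rest.yield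

/-- A parse tree with root `A`: a forest over the one-symbol sentential form `A`. -/
abbrev ContextFreeGrammar.ParseTree {T : Type*} (G : ContextFreeGrammar T) (A : G.NT) : Type _ :=
  G.ParseForest [Symbol.nonterminal A]

/-- The set of all parse trees of the string `w` as `A`. -/
def ContextFreeGrammar.parseTrees {T : Type*} (G : ContextFreeGrammar T) (A : G.NT)
    (w : List T) : Set (G.ParseTree A) :=
  {t | t.yield = w}

/-- A GF(2)-grammar over the alphabet `T`. Syntactically it is an ordinary grammar (`A → γ` stands
for the rule in which the symbols of `γ` are joined by GF(2)-concatenation), and every string must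
have only finitely many parse trees in that ordinary grammar. -/
structure GF2Grammar (T : Type*) extends ContextFreeGrammar T where
  finite_parseTrees : ∀ w : List T,
    (toContextFreeGrammar.parseTrees toContextFreeGrammar.initial w).Finite

/-- The language described by a GF(2)-grammar: all strings with an odd number of parse trees as the
initial symbol. -/
def GF2Grammar.language {T : Type*} (G : GF2Grammar T) : Language T :=
  {w | Odd (G.parseTrees G.initial w).ncard}

/-- A language is described by a GF(2)-grammar. -/
def Language.IsGF2 {T : Type*} (L : Language T) : Prop :=
  ∃ G : GF2Grammar T, G.language = L

/-! Restrict parse-tree parities to `aⁱ bʲ` and encode them as series over GF(2) in `x` (for `a`)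
and `y` (for `b`). On powers of one letter, concatenation is commutative multiplication, so the
unary series solve a polynomial system. A cut of `aⁱ bʲ` falls among the `a`s or among the `b`s.
Hence the binary series, minus its part without `b`, obeys a twisted Leibniz rule and solves a
linear system with coefficients built from series in `x` alone and series in `y` alone
(`binarySeries_sub_eq_leibnizSum`).

The determinant of this system is nonzero because it is nonzero at the origin: there, a nonzero
Jacobian entry lets a tree be enlarged without changing its yield, and finite ambiguity forbids
doing this forever (`det_one_sub_jacobian_trimRules_ne_zero`). The series in `y` are algebraic over
`k = Frac(K⟦x⟧[y])` (`isAlgebraic_of_eq_sum_prod`), so the solution is a polynomial in them over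
`k`. After multiplication by some nonzero `s ∈ K⟦x⟧[y]`, its `y`-coefficients span a
finite-dimensional space (`exists_mul_mem_finiteRank`). No such `s` exists for `∑ x^(2^n) y^(2^n)`,
by the gaps between powers of two (`mul_notMem_finiteRank`). -/

namespace ContextFreeGrammar

variable {T : Type*} {G : ContextFreeGrammar T}

/-! ### Decomposing parse forests. -/

namespace ParseForest

/-- Put a forest over one symbol in front of a forest. -/
def cons {α : List (Symbol T G.NT)} :
    {X : Symbol T G.NT} → G.ParseForest [X] → G.ParseForest α → G.ParseForest (X :: α)
  | _, .leaf t _, g => .leaf t g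
  | _, .node A γ h children _, g => .node A γ h children g

/-- The part of a forest over its first symbol. -/
def head {α : List (Symbol T G.NT)} {X : Symbol T G.NT} :
    G.ParseForest (X :: α) → G.ParseForest [X]
  | .leaf t _ => .leaf t .nil
  | .node A γ h children _ => .node A γ h children .nil

/-- The part of a forest over all symbols but the first one. -/
def tail {α : List (Symbol T G.NT)} {X : Symbol T G.NT} :
    G.ParseForest (X :: α) → G.ParseForest α
  | .leaf _ rest => rest
  | .node _ _ _ _ rest => rest

theorem eq_nil (f : G.ParseForest []) : f = .nil := by cases f; rfl

instance : Unique (G.ParseForest []) := ⟨⟨.nil⟩, eq_nil⟩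

/-- A forest over `X :: α` is a forest over `X` followed by a forest over `α`. -/
def consEquiv (X : Symbol T G.NT) (α : List (Symbol T G.NT)) :
    G.ParseForest (X :: α) ≃ G.ParseForest [X] × G.ParseForest α where
  toFun f := (f.head, f.tail)
  invFun p := p.1.cons p.2
  left_inv f := by cases f <;> rfl
  right_inv p := by
    obtain ⟨f, g⟩ := p
    cases f with
    | leaf t r => cases r; rfl
    | node A γ h c r => cases r; rfl

theorem yield_head_append_yield_tail {X : Symbol T G.NT} {α : List (Symbol T G.NT)}
    (f : G.ParseForest (X :: α)) : f.head.yield ++ f.tail.yield = f.yield := by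
  cases f <;> simp [head, tail, yield]

theorem yield_cons {X : Symbol T G.NT} {α : List (Symbol T G.NT)}
    (f : G.ParseForest [X]) (g : G.ParseForest α) : (f.cons g).yield = f.yield ++ g.yield := by
  cases f with
  | leaf t r => cases r; simp [cons, yield]
  | node A γ h c r => cases r; simp [cons, yield]

/-- Trees with root `A` correspond to forests over the right-hand sides of the rules for `A`. -/
def nodeEquiv (A : G.NT) :
    G.ParseTree A ≃ Σ r : {r : ContextFreeRule T G.NT // r ∈ G.rules ∧ r.input = A},
      G.ParseForest r.1.output where
  toFun
    | .node _ γ h children _ => ⟨⟨⟨A, γ⟩, h, rfl⟩, children⟩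
  invFun
    | ⟨⟨⟨_, γ⟩, h, e⟩, children⟩ => .node A γ (by subst e; exact h) children .nil
  left_inv f := by cases f with | node A γ h c r => cases r; rfl
  right_inv := by
    rintro ⟨⟨⟨_, γ⟩, h, e⟩, c⟩
    subst e
    rfl

theorem yield_nodeEquiv {A : G.NT} (f : G.ParseTree A) : (nodeEquiv A f).2.yield = f.yield := by
  cases f with
  | node A γ h c r => cases r; exact (List.append_nil _).symm

/-- The number of internal nodes of a forest. -/
def size : {α : List (Symbol T G.NT)} → G.ParseForest α → ℕ
  | _, .nil => 0
  | _, .leaf _ rest => rest.size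
  | _, .node _ _ _ children rest => children.size + rest.size + 1

theorem size_cons {X : Symbol T G.NT} {α : List (Symbol T G.NT)}
    (f : G.ParseForest [X]) (g : G.ParseForest α) : (f.cons g).size = f.size + g.size := by
  cases f with
  | leaf t r => cases r; simp [cons, size]
  | node A γ h c r => cases r; simp [cons, size]; omega

end ParseForest

/-! ### Finite ambiguity and parities of forest counts. -/

open ParseForest

variable (G) in
/-- The forests over `α` with yield `w`. -/
abbrev ForestsOf (α : List (Symbol T G.NT)) (w : List T) : Type _ :=
  {f : G.ParseForest α // f.yield = w}

variable (G) in
/-- Every string has finitely many forests over `α`. -/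
def FinitelyAmbiguous (α : List (Symbol T G.NT)) : Prop :=
  ∀ w, Finite (G.ForestsOf α w)

variable (G) in
/-- The parity of the number of forests over `α` with yield `w`. -/
noncomputable def parity (α : List (Symbol T G.NT)) (w : List T) : ZMod 2 :=
  (Nat.card (G.ForestsOf α w) : ZMod 2)

/-- Padding with the fixed forest `g` embeds the forests over `[X]` with a given yield into a finite
set. -/
theorem FinitelyAmbiguous.head {X : Symbol T G.NT} {α : List (Symbol T G.NT)}
    (h : G.FinitelyAmbiguous (X :: α)) (g : G.ParseForest α) : G.FinitelyAmbiguous [X] := by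
  intro w
  have := h (w ++ g.yield)
  refine Finite.of_injective (β := G.ForestsOf (X :: α) (w ++ g.yield))
    (fun f => ⟨f.1.cons g, by rw [yield_cons, f.2]⟩) ?_
  intro f f' e
  have := (consEquiv X α).symm.injective (a₁ := (f.1, g)) (a₂ := (f'.1, g)) (congrArg Subtype.val e)
  exact Subtype.ext (congrArg Prod.fst this)

theorem FinitelyAmbiguous.tail {X : Symbol T G.NT} {α : List (Symbol T G.NT)}
    (h : G.FinitelyAmbiguous (X :: α)) (g : G.ParseForest [X]) : G.FinitelyAmbiguous α := by
  intro w
  have := h (g.yield ++ w)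
  refine Finite.of_injective (β := G.ForestsOf (X :: α) (g.yield ++ w))
    (fun f => ⟨g.cons f.1, by rw [yield_cons, f.2]⟩) ?_
  intro f f' e
  have := (consEquiv X α).symm.injective (a₁ := (g, f.1)) (a₂ := (g, f'.1)) (congrArg Subtype.val e)
  exact Subtype.ext (congrArg Prod.snd this)

theorem FinitelyAmbiguous.symbol {X : Symbol T G.NT} {α : List (Symbol T G.NT)}
    (h : G.FinitelyAmbiguous α) (f : G.ParseForest α) (hX : X ∈ α) :
    G.FinitelyAmbiguous [X] ∧ Nonempty (G.ParseForest [X]) := by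
  induction α with
  | nil => simp at hX
  | cons Y α ih =>
    rcases List.mem_cons.1 hX with rfl | hX
    · exact ⟨h.head f.tail, ⟨f.head⟩⟩
    · exact ih (h.tail f.head) f.tail hX

/-- The forests over `α` that are right-hand sides of rules for `A` make up the trees of `A`. -/
def forestsOfEquiv (A : G.NT) (w : List T) :
    G.ForestsOf [.nonterminal A] w ≃
      Σ r : {r : ContextFreeRule T G.NT // r ∈ G.rules ∧ r.input = A}, G.ForestsOf r.1.output w :=
  ((nodeEquiv A).subtypeEquiv (q := fun p => p.2.yield = w)
    (fun f => by rw [yield_nodeEquiv])).trans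
    { toFun p := ⟨p.1.1, p.1.2, p.2⟩
      invFun p := ⟨⟨p.1, p.2.1⟩, p.2.2⟩
      left_inv _ := rfl
      right_inv _ := rfl }

theorem FinitelyAmbiguous.output {r : ContextFreeRule T G.NT} (hr : r ∈ G.rules)
    (h : G.FinitelyAmbiguous [.nonterminal r.input]) : G.FinitelyAmbiguous r.output := by
  intro w
  have := h w
  exact Finite.of_injective
    (fun f => (forestsOfEquiv r.input w).symm ⟨⟨r, hr, rfl⟩, f⟩)
    fun f f' e => by simpa using e

open Classical in
theorem parity_nonterminal {A : G.NT} (h : G.FinitelyAmbiguous [.nonterminal A]) (w : List T) :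
    G.parity [.nonterminal A] w =
      ∑ r ∈ G.rules with r.input = A, G.parity r.output w := by
  have hfin (r : {r : ContextFreeRule T G.NT // r ∈ G.rules ∧ r.input = A}) :
      Finite (G.ForestsOf r.1.output w) := by
    obtain ⟨r, hr, rfl⟩ := r
    exact h.output hr w
  have hft : Finite {r : ContextFreeRule T G.NT // r ∈ G.rules ∧ r.input = A} :=
    (G.rules.finite_toSet.subset (fun r hr => hr.1) : {r | r ∈ G.rules ∧ r.input = A}.Finite)
  have := Fintype.ofFinite {r : ContextFreeRule T G.NT // r ∈ G.rules ∧ r.input = A}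
  simp only [parity]
  rw [Nat.card_congr (forestsOfEquiv A w), Nat.card_sigma, Nat.cast_sum]
  refine (Finset.sum_subtype (p := fun r => r ∈ G.rules ∧ r.input = A)
    (G.rules.filter (·.input = A)) (by simp)
    (fun r => (Nat.card (G.ForestsOf r.output w) : ZMod 2))).symm

theorem parity_nil (w : List T) [Decidable (w = [])] :
    G.parity [] w = if w = [] then 1 else 0 := by
  unfold parity
  split_ifs with h
  · subst h
    have : Unique (G.ForestsOf [] []) := ⟨⟨⟨.nil, rfl⟩⟩, fun f => Subtype.ext (eq_nil _)⟩
    simp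
  · have : IsEmpty (G.ForestsOf [] w) := ⟨fun f => h (by rw [← f.2, eq_nil f.1]; rfl)⟩
    simp

theorem parity_terminal (t : T) (w : List T) [Decidable (w = [t])] :
    G.parity [.terminal t] w = if w = [t] then 1 else 0 := by
  have key (f : G.ParseForest [.terminal t]) : f = .leaf t .nil := by
    cases f with | leaf t r => rw [eq_nil r]
  unfold parity
  split_ifs with h
  · subst h
    have : Unique (G.ForestsOf [.terminal t] [t]) :=
      ⟨⟨⟨.leaf t .nil, rfl⟩⟩, fun f => Subtype.ext (key _)⟩
    simp
  · have : IsEmpty (G.ForestsOf [.terminal t] w) := ⟨fun f => h (by rw [← f.2, key f.1]; rfl)⟩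
    simp

theorem exists_of_parity_ne_zero {α : List (Symbol T G.NT)} {w : List T} (h : G.parity α w ≠ 0) :
    ∃ f : G.ParseForest α, f.yield = w := by
  by_contra! hc
  have : IsEmpty (G.ForestsOf α w) := ⟨fun f => hc f.1 f.2⟩
  simp [parity] at h

end ContextFreeGrammar

/-! ### Concatenation of weighted languages on `aⁱ bʲ`. -/

/-- The Cauchy product of two weighted languages. -/
def List.cauchyProd {T R : Type*} [Semiring R] (φ ψ : List T → R) (w : List T) : R :=
  ∑ k ∈ Finset.range (w.length + 1), φ (w.take k) * ψ (w.drop k)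

theorem List.cauchyProd_nil {T R : Type*} [Semiring R] (φ ψ : List T → R) :
    List.cauchyProd φ ψ [] = φ [] * ψ [] := by
  simp [List.cauchyProd]

theorem List.cauchyProd_cons {T R : Type*} [Semiring R] (φ ψ : List T → R) (c : T) (w : List T) :
    List.cauchyProd φ ψ (c :: w) =
      φ [] * ψ (c :: w) + List.cauchyProd (fun u => φ (c :: u)) ψ w := by
  simp only [List.cauchyProd, List.length_cons]
  rw [Finset.sum_range_succ', add_comm]
  simp

theorem List.cauchyProd_replicate {T R : Type*} [Semiring R] (φ ψ : List T → R) (a : T) (n : ℕ) :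
    List.cauchyProd φ ψ (List.replicate n a) =
      ∑ p ∈ Finset.HasAntidiagonal.antidiagonal n, φ (List.replicate p.1 a) * ψ (List.replicate p.2 a) := by
  induction n generalizing φ with
  | zero => simp [List.cauchyProd_nil]
  | succ n ih =>
    rw [List.replicate_succ, List.cauchyProd_cons, ih, Finset.Nat.sum_antidiagonal_succ]
    simp [List.replicate_succ]

/-- A cut falls in the `a`-block or in the `b`-block; the cut at the border is counted in both sums,
hence the subtraction. -/
theorem List.cauchyProd_replicate_append {T R : Type*} [Ring R] (φ ψ : List T → R) (a b : T)
    (i j : ℕ) :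
    List.cauchyProd φ ψ (List.replicate i a ++ List.replicate j b) =
      (∑ p ∈ Finset.HasAntidiagonal.antidiagonal i,
        φ (List.replicate p.1 a) * ψ (List.replicate p.2 a ++ List.replicate j b)) +
      (∑ p ∈ Finset.HasAntidiagonal.antidiagonal j,
        φ (List.replicate i a ++ List.replicate p.1 b) * ψ (List.replicate p.2 b)) -
      φ (List.replicate i a) * ψ (List.replicate j b) := by
  induction i generalizing φ with
  | zero => simp [List.cauchyProd_replicate]
  | succ n ih =>
    rw [List.replicate_succ, List.cons_append, List.cauchyProd_cons, ih,
      Finset.Nat.sum_antidiagonal_succ]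
    simp [List.replicate_succ, add_assoc, add_sub_assoc]

namespace ContextFreeGrammar

variable {T : Type*} {G : ContextFreeGrammar T}

open ParseForest

/-- Forests are sorted by the length of the yield of their first tree, which determines where `w` is
cut. -/
theorem parity_cons {X : Symbol T G.NT} {α : List (Symbol T G.NT)}
    (h : G.FinitelyAmbiguous (X :: α)) (w : List T) :
    G.parity (X :: α) w = List.cauchyProd (G.parity [X]) (G.parity α) w := by
  have := h w
  let ℓ : G.ForestsOf (X :: α) w → Fin (w.length + 1) := fun f =>
    ⟨f.1.head.yield.length, by
      have := congrArg List.length ((yield_head_append_yield_tail f.1).trans f.2)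
      rw [List.length_append] at this
      omega⟩
  have e (k : Fin (w.length + 1)) : {f // ℓ f = k} ≃
      G.ForestsOf [X] (w.take k) × G.ForestsOf α (w.drop k) :=
    { toFun f :=
        have hw := (yield_head_append_yield_tail f.1.1).trans f.1.2
        have hk : f.1.1.head.yield.length = k := congrArg Fin.val f.2
        ⟨⟨f.1.1.head, by
            rw [← hk]; exact List.take_left.symm.trans (congrArg (List.take _) hw)⟩,
          ⟨f.1.1.tail, by
            rw [← hk]; exact List.drop_left.symm.trans (congrArg (List.drop _) hw)⟩⟩
      invFun p := ⟨⟨p.1.1.cons p.2.1, by rw [yield_cons, p.1.2, p.2.2, List.take_append_drop]⟩, by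
        have := congrArg Prod.fst ((consEquiv X α).right_inv (p.1.1, p.2.1))
        change (p.1.1.cons p.2.1).head = p.1.1 at this
        ext
        simp only [ℓ, this, p.1.2, List.length_take]
        have := k.2
        omega⟩
      left_inv f := Subtype.ext (Subtype.ext ((consEquiv X α).left_inv f.1.1))
      right_inv p := by
        have := (consEquiv X α).right_inv (p.1.1, p.2.1)
        exact Prod.ext (Subtype.ext (congrArg Prod.fst this))
          (Subtype.ext (congrArg Prod.snd this)) }
  unfold parity
  rw [← Nat.card_congr (Equiv.sigmaFiberEquiv ℓ), Nat.card_sigma]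
  simp only [Nat.card_congr (e _), Nat.card_prod, Nat.cast_sum, Nat.cast_mul]
  rw [List.cauchyProd, Finset.sum_range (n := w.length + 1)]

end ContextFreeGrammar

/-! ### Twisted derivations, linear systems and algebraicity. -/

namespace ContextFreeRule

section leibniz

variable {σ R S M N : Type*} [CommRing R] [CommRing S] [AddCommGroup M] [Module R M]
  [AddCommGroup N] [Module R N]

/-- The value at a product of letters of the `(l, r)`-twisted derivation that sends every letter
`X` to `d X`. -/
def leibnizSum (l r : σ → R) (d : σ → M) : List σ → M
  | [] => 0
  | X :: α => l X • leibnizSum l r d α + (α.map r).prod • d X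

theorem map_leibnizSum (f : R →+* S) (l r d : σ → R) (α : List σ) :
    f (leibnizSum l r d α) = leibnizSum (f ∘ l) (f ∘ r) (f ∘ d) α := by
  induction α with
  | nil => simp [leibnizSum]
  | cons X α ih => simp [leibnizSum, ih, map_list_prod]

theorem leibnizSum_map {τ : Type*} (g : τ → σ) (l r : σ → R) (d : σ → M) (α : List τ) :
    leibnizSum l r d (α.map g) = leibnizSum (l ∘ g) (r ∘ g) (d ∘ g) α := by
  induction α with
  | nil => rfl
  | cons X α ih => simp [leibnizSum, ih]

theorem leibnizSum_mem (l r : σ → R) (d : σ → M) (V : Submodule R M) (α : List σ)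
    (h : ∀ X ∈ α, d X ∈ V) : leibnizSum l r d α ∈ V := by
  induction α with
  | nil => exact V.zero_mem
  | cons X α ih =>
    simp only [List.mem_cons, forall_eq_or_imp] at h
    exact V.add_mem (V.smul_mem _ (ih h.2)) (V.smul_mem _ h.1)

theorem _root_.Derivation.map_list_prod {A : Type*} [CommRing A] [Algebra A R] [Module A M]
    (D : Derivation A R M) (q : σ → R) (α : List σ) :
    D (α.map q).prod = leibnizSum q q (fun X => D (q X)) α := by
  induction α with
  | nil => simp [leibnizSum]
  | cons X α ih => simp [leibnizSum, ih]

end leibniz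

variable {T ι : Type*}

open Classical in
/-- The indicator function of the nonterminal `B`. -/
noncomputable def indicator (R : Type*) [CommRing R] (B : ι) : Symbol T ι → R
  | .terminal _ => 0
  | .nonterminal C => if C = B then 1 else 0

theorem map_comp_indicator {R S : Type*} [CommRing R] [CommRing S] (f : R →+* S) (B : ι) :
    f ∘ (indicator (T := T) R B) = indicator S B := by
  funext X
  cases X <;> simp [indicator, apply_ite f]

/-- The part of a function on symbols supported on the terminals. -/
def onTerminals {M : Type*} [Zero M] (d : Symbol T ι → M) : Symbol T ι → M
  | .terminal t => d (.terminal t)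
  | .nonterminal _ => 0

/-- Linearity in `d` separates the unknowns, at nonterminals, from the known values at terminals. -/
theorem leibnizSum_eq_sum_indicator [Fintype ι] {R M : Type*} [CommRing R] [AddCommGroup M]
    [Module R M] (l r : Symbol T ι → R) (d : Symbol T ι → M) (α : List (Symbol T ι)) :
    leibnizSum l r d α =
      ∑ B, leibnizSum l r (indicator R B) α • d (.nonterminal B) +
        leibnizSum l r (onTerminals d) α := by
  classical
  induction α with
  | nil => simp [leibnizSum]
  | cons X α ih =>
    simp only [leibnizSum, ih, add_smul, Finset.sum_add_distrib, smul_add, smul_eq_mul, mul_smul,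
      Finset.smul_sum]
    cases X <;> simp [indicator, onTerminals] <;> abel

open Classical in
/-- The linear part of the system of equations given by a set of rules, where the symbols to the
left of the differentiated one are evaluated by `l` and the ones to the right by `r`. -/
noncomputable def jacobian {R : Type*} [CommRing R] (rules : Finset (ContextFreeRule T ι))
    (l r : Symbol T ι → R) : Matrix ι ι R :=
  .of fun A B => ∑ ρ ∈ rules with ρ.input = A, leibnizSum l r (indicator R B) ρ.output

theorem map_jacobian {R S : Type*} [CommRing R] [CommRing S] (f : R →+* S)
    (rules : Finset (ContextFreeRule T ι)) (l r : Symbol T ι → R) :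
    (jacobian rules l r).map f = jacobian rules (f ∘ l) (f ∘ r) := by
  ext A B
  simp [jacobian, map_leibnizSum, map_comp_indicator]

open Classical in
theorem map_det_one_sub_jacobian [Fintype ι] {R S : Type*} [CommRing R] [CommRing S] (f : R →+* S)
    (rules : Finset (ContextFreeRule T ι)) (l r : Symbol T ι → R) :
    f (1 - jacobian rules l r).det = (1 - jacobian rules (f ∘ l) (f ∘ r)).det := by
  rw [RingHom.map_det, map_sub, map_one, RingHom.mapMatrix_apply, map_jacobian]

open Classical in
/-- A solution of a linear system lies in every submodule containing the right-hand side, as soon as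
the determinant is invertible. -/
theorem _root_.Matrix.mem_of_sum_smul_mem [Fintype ι] {E M : Type*} [Field E] [AddCommGroup M]
    [Module E M] {m : Matrix ι ι E} (hm : m.det ≠ 0) (V : Submodule E M) (v : ι → M)
    (h : ∀ A, ∑ B, m A B • v B ∈ V) (C : ι) : v C ∈ V := by
  have key : ∑ A, m⁻¹ C A • ∑ B, m A B • v B = v C := by
    simp only [Finset.smul_sum, smul_smul]
    rw [Finset.sum_comm]
    simp only [← Finset.sum_smul, ← Matrix.mul_apply, Matrix.nonsing_inv_mul m hm.isUnit]
    simp [Matrix.one_apply]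
  rw [← key]
  exact V.sum_mem fun A _ => V.smul_mem _ (h A)

open Classical in
-- Moving the unknowns to one side leaves `(1 - jacobian)` applied to them equal to terminal
-- contributions, which lie in `V`.
theorem mem_of_eq_sum_leibnizSum [Fintype ι] {E M : Type*} [Field E] [AddCommGroup M] [Module E M]
    (rules : Finset (ContextFreeRule T ι)) (l r : Symbol T ι → E) (d : Symbol T ι → M)
    (V : Submodule E M) (hdet : (1 - jacobian rules l r).det ≠ 0)
    (hd : ∀ A, d (.nonterminal A) =
      ∑ ρ ∈ rules with ρ.input = A, leibnizSum l r d ρ.output)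
    (hterm : ∀ t, d (.terminal t) ∈ V) (A : ι) : d (.nonterminal A) ∈ V := by
  refine Matrix.mem_of_sum_smul_mem hdet V (fun B => d (.nonterminal B)) (fun A => ?_) A
  have : ∑ B, (1 - jacobian rules l r) A B • d (.nonterminal B) =
      ∑ ρ ∈ rules with ρ.input = A, leibnizSum l r (onTerminals d) ρ.output := by
    simp only [Matrix.sub_apply, sub_smul, Finset.sum_sub_distrib]
    rw [sub_eq_iff_eq_add]
    simp only [Matrix.one_apply, ite_smul, one_smul, zero_smul, Finset.sum_ite_eq,
      Finset.mem_univ, if_true]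
    rw [hd A]
    simp only [jacobian, Matrix.of_apply, Finset.sum_smul]
    rw [Finset.sum_comm, ← Finset.sum_add_distrib]
    exact Finset.sum_congr rfl fun ρ _ => by rw [leibnizSum_eq_sum_indicator, add_comm]
  rw [this]
  refine V.sum_mem fun ρ _ => leibnizSum_mem _ _ _ _ _ fun X _ => ?_
  cases X with
  | terminal t => exact hterm t
  | nonterminal B => exact V.zero_mem

open Classical in
-- A Jacobian criterion: the differentials of the solutions satisfy a homogeneous system with
-- nonzero determinant, so the finitely generated field `E` has no differentials over `k`. It is
-- then separable algebraic, in any characteristic.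
theorem isAlgebraic_of_eq_sum_prod [Fintype ι] {k F : Type*} [Field k] [Field F] [Algebra k F]
    (rules : Finset (ContextFreeRule T ι)) (q : Symbol T ι → F)
    (hdet : (1 - jacobian rules q q).det ≠ 0)
    (hq : ∀ A, q (.nonterminal A) = ∑ ρ ∈ rules with ρ.input = A, (ρ.output.map q).prod)
    (hterm : ∀ t, q (.terminal t) ∈ (algebraMap k F).range) (A : ι) :
    IsAlgebraic k (q (.nonterminal A)) := by
  set S : Set F := Set.range fun A => q (.nonterminal A)
  let E := IntermediateField.adjoin k S
  have hmem (X : Symbol T ι) : q X ∈ E := by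
    cases X with
    | terminal t =>
      obtain ⟨c, hc⟩ := hterm t
      rw [← hc]
      exact E.algebraMap_mem c
    | nonterminal B => exact IntermediateField.subset_adjoin k S ⟨B, rfl⟩
  let q' : Symbol T ι → E := fun X => ⟨q X, hmem X⟩
  have hq' : algebraMap E F ∘ q' = q := rfl
  have hdet' : (1 - jacobian rules q' q').det ≠ 0 := by
    intro h
    have := map_det_one_sub_jacobian (algebraMap E F) rules q' q'
    rw [hq', h, map_zero] at this
    exact hdet this.symm
  let D := KaehlerDifferential.D k E
  have hD (B : ι) : D (q' (.nonterminal B)) = 0 := by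
    -- With `V = ⊥` the membership lemma says that the homogeneous system has only the zero
    -- solution.
    have := mem_of_eq_sum_leibnizSum rules q' q' (fun X => D (q' X)) ⊥ hdet' (fun A => ?_) ?_ B
    · simpa using this
    · have : q' (.nonterminal A) = ∑ ρ ∈ rules with ρ.input = A, (ρ.output.map q').prod := by
        apply (algebraMap E F).injective
        simp only [map_sum, map_list_prod, List.map_map, hq']
        exact hq A
      rw [this, map_sum]
      exact Finset.sum_congr rfl fun ρ _ => D.map_list_prod q' ρ.output
    · intro t
      obtain ⟨c, hc⟩ := hterm t
      have : q' (.terminal t) = algebraMap k E c := Subtype.ext hc.symm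
      simp [this]
  have hD0 (x : F) (hx : x ∈ E) : D ⟨x, hx⟩ = 0 := by
    induction hx using IntermediateField.adjoin_induction with
    | mem x hx => obtain ⟨B, rfl⟩ := hx; exact hD B
    | algebraMap x => exact D.map_algebraMap x
    | add x y hx hy h₁ h₂ =>
      exact (D.map_add ⟨x, hx⟩ ⟨y, hy⟩).trans (by rw [h₁, h₂, add_zero])
    | inv x hx h => exact (D.leibniz_inv ⟨x, hx⟩).trans (by rw [h, smul_zero])
    | mul x y hx hy h₁ h₂ =>
      exact (D.leibniz ⟨x, hx⟩ ⟨y, hy⟩).trans (by rw [h₁, h₂, smul_zero, smul_zero, add_zero])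
  have hsub : Subsingleton (Ω[E⁄k]) := by
    refine subsingleton_of_forall_eq 0 fun y => ?_
    have hy : y ∈ Submodule.span E (Set.range (KaehlerDifferential.D k E)) := by
      rw [KaehlerDifferential.span_range_derivation]; trivial
    rw [← Submodule.mem_bot (R := E)]
    refine Submodule.span_le.2 ?_ hy
    rintro _ ⟨⟨x, hx⟩, rfl⟩
    exact hD0 x hx
  have : Algebra.FormallyUnramified k E := ⟨hsub⟩
  have : Algebra.EssFiniteType k E :=
    IntermediateField.essFiniteType_iff.2
      ⟨(Set.finite_range fun A => q (.nonterminal A)).toFinset, by simp [E, S]⟩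
  have := Algebra.FormallyUnramified.isSeparable k E
  exact (isAlgebraic_algebraMap_iff (algebraMap E F).injective).2
    (Algebra.IsAlgebraic.isAlgebraic (R := k) (q' (.nonterminal A)))

open Classical in
-- Such an `m` is nilpotent: a vector fixed by `m` vanishes by strong induction on the rank.
theorem _root_.Matrix.det_one_sub_ne_zero_of_rank [Fintype ι] {K : Type*} [Field K]
    (m : Matrix ι ι K) (rank : ι → ℕ) (h : ∀ A B, m A B ≠ 0 → rank B < rank A) :
    (1 - m).det ≠ 0 := by
  intro hdet
  obtain ⟨v, hv, hv'⟩ := Matrix.exists_mulVec_eq_zero_iff.2 hdet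
  apply hv
  rw [Matrix.sub_mulVec, Matrix.one_mulVec, sub_eq_zero] at hv'
  have key (n : ℕ) : ∀ A, rank A = n → v A = 0 := by
    induction n using Nat.strong_induction_on with
    | _ n ih =>
      intro A hA
      rw [hv']
      refine Finset.sum_eq_zero fun B _ => ?_
      by_cases hm : m A B = 0
      · simp [hm]
      · rw [ih _ (hA ▸ h A B hm) B rfl, mul_zero]
  funext A
  exact key _ A rfl

theorem exists_of_leibnizSum_indicator_ne_zero {R : Type*} [CommRing R] [IsDomain R]
    {l r : Symbol T ι → R} {B : ι} {α : List (Symbol T ι)} (h : leibnizSum l r (indicator R B) α ≠ 0) :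
    ∃ β γ, α = β ++ .nonterminal B :: γ ∧ (β.map l).prod ≠ 0 ∧ (γ.map r).prod ≠ 0 := by
  induction α with
  | nil => simp [leibnizSum] at h
  | cons X α ih =>
    by_cases h₁ : l X • leibnizSum l r (indicator R B) α = 0
    · rw [leibnizSum, h₁, zero_add, smul_eq_mul] at h
      cases X with
      | terminal t => simp [indicator] at h
      | nonterminal C =>
        by_cases hC : C = B
        · subst hC
          exact ⟨[], α, rfl, by simp, left_ne_zero_of_mul h⟩
        · simp [indicator, hC] at h
    · rw [smul_eq_mul] at h₁
      obtain ⟨β, γ, rfl, hβ, hγ⟩ := ih (right_ne_zero_of_mul h₁)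
      exact ⟨X :: β, γ, rfl, by simpa using ⟨left_ne_zero_of_mul h₁, by simpa using hβ⟩, hγ⟩

end ContextFreeRule

/-! ### Series of finite rank. -/

namespace PowerSeries

variable (K : Type*) [Field K]

/-- Bivariate power series, seen as power series in the second variable, whose coefficients span a
finite-dimensional space of power series in the first variable. -/
def finiteRank : Subring K⟦X⟧⟦X⟧ where
  carrier := {h | ∃ V : Submodule K K⟦X⟧, V.FG ∧ ∀ j, coeff j h ∈ V}
  zero_mem' := ⟨⊥, Submodule.fg_bot, by simp⟩
  one_mem' := by
    refine ⟨K ∙ (1 : K⟦X⟧), Submodule.fg_span_singleton _, fun j => ?_⟩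
    rw [coeff_one]
    split_ifs
    · exact Submodule.mem_span_singleton_self _
    · exact zero_mem _
  add_mem' := by
    rintro f g ⟨V, hV, hf⟩ ⟨W, hW, hg⟩
    refine ⟨V ⊔ W, hV.sup hW, fun j => ?_⟩
    rw [map_add]
    exact add_mem (Submodule.mem_sup_left (hf j)) (Submodule.mem_sup_right (hg j))
  neg_mem' := by
    rintro f ⟨V, hV, hf⟩
    exact ⟨V, hV, fun j => by rw [map_neg]; exact neg_mem (hf j)⟩
  mul_mem' := by
    rintro f g ⟨V, hV, hf⟩ ⟨W, hW, hg⟩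
    refine ⟨V * W, hV.mul hW, fun j => ?_⟩
    rw [coeff_mul]
    exact sum_mem fun p _ => Submodule.mul_mem_mul (hf _) (hg _)

variable {K}

theorem C_mem_finiteRank (f : K⟦X⟧) : C f ∈ finiteRank K := by
  refine ⟨K ∙ f, Submodule.fg_span_singleton _, fun j => ?_⟩
  rw [coeff_C]
  split_ifs
  · exact Submodule.mem_span_singleton_self _
  · exact zero_mem _

theorem map_C_mem_finiteRank (f : K⟦X⟧) : PowerSeries.map C f ∈ finiteRank K := by
  refine ⟨K ∙ (1 : K⟦X⟧), Submodule.fg_span_singleton _, fun j => ?_⟩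
  rw [coeff_map, ← mul_one (C _), ← smul_eq_C_mul]
  exact Submodule.smul_mem _ _ (Submodule.mem_span_singleton_self _)

theorem coe_mem_finiteRank (s : Polynomial K⟦X⟧) : (s : K⟦X⟧⟦X⟧) ∈ finiteRank K := by
  induction s using Polynomial.induction_on' with
  | add s t hs ht => rw [Polynomial.coe_add]; exact add_mem hs ht
  | monomial n f =>
    rw [← Polynomial.C_mul_X_pow_eq_monomial, Polynomial.coe_mul, Polynomial.coe_C,
      Polynomial.coe_pow, Polynomial.coe_X]
    have hX : (X : K⟦X⟧⟦X⟧) = PowerSeries.map C X := by rw [map_X]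
    exact mul_mem (C_mem_finiteRank f) (pow_mem (hX ▸ map_C_mem_finiteRank X) n)

/-- With `d` the degree of `s` and `N ≥ d`, the coefficient at `d + 2^N` is the leading coefficient
of `s` times `X^(2^N)`. These are infinitely many distinct elements, while a finite-dimensional
space over a finite field is finite. -/
theorem mul_notMem_finiteRank [Finite K] {F : K⟦X⟧⟦X⟧}
    (hF : ∀ n, coeff (2 ^ n) F = X ^ 2 ^ n) (hF' : ∀ j, (∀ n, j ≠ 2 ^ n) → coeff j F = 0)
    {s : Polynomial K⟦X⟧} (hs : s ≠ 0) : (s : K⟦X⟧⟦X⟧) * F ∉ finiteRank K := by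
  rintro ⟨V, hV, h⟩
  have hfin : Finite V := by
    have := Module.Finite.iff_fg.2 hV
    exact Module.finite_of_finite K
  have hrow (n : ℕ) : coeff (s.natDegree + 2 ^ (s.natDegree + n)) ((s : K⟦X⟧⟦X⟧) * F) =
      s.leadingCoeff * X ^ 2 ^ (s.natDegree + n) := by
    rw [coeff_mul, Finset.sum_eq_single (s.natDegree, 2 ^ (s.natDegree + n))]
    · simp [hF]
    · rintro ⟨u, v⟩ huv hne
      rw [Finset.HasAntidiagonal.mem_antidiagonal] at huv
      simp only at huv ⊢
      rw [Polynomial.coeff_coe]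
      by_cases hu : s.natDegree < u
      · rw [Polynomial.coeff_eq_zero_of_natDegree_lt hu, zero_mul]
      · rw [hF', mul_zero]
        rintro m rfl
        -- The exponent lies between `2^N` and `2^N + d < 2^(N+1)`, where `N = d + n`, so `2^N` is
        -- the only power of two available.
        have h₁ : s.natDegree + n < 2 ^ (s.natDegree + n) := Nat.lt_two_pow_self
        have h₂ : s.natDegree + n ≤ m :=
          (Nat.pow_le_pow_iff_right (by norm_num : 1 < 2)).1 (by omega)
        have h₃ : m < s.natDegree + n + 1 :=
          (Nat.pow_lt_pow_iff_right (by norm_num : 1 < 2)).1 (by rw [pow_succ]; omega)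
        obtain rfl : m = s.natDegree + n := by omega
        exact hne (by simpa using huv)
    · simp
  refine not_injective_infinite_finite
    (fun n : ℕ => (⟨_, h (s.natDegree + 2 ^ (s.natDegree + n))⟩ : V)) fun n n' e => ?_
  have e := congrArg Subtype.val e
  simp only [hrow] at e
  have e := congrArg order (mul_left_cancel₀ (Polynomial.leadingCoeff_ne_zero.2 hs) e)
  rw [order_X_pow, order_X_pow] at e
  have e := Nat.pow_right_injective le_rfl (ENat.natCast_inj.1 e)
  omega

variable (K) in
/-- The elements of the fraction field that become of finite rank after multiplication by a nonzero
polynomial in the second variable. -/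
noncomputable def finiteRankFractions : Subring (FractionRing K⟦X⟧⟦X⟧) where
  carrier := {e | ∃ s : Polynomial K⟦X⟧, s ≠ 0 ∧ ∃ h ∈ finiteRank K,
    algebraMap K⟦X⟧⟦X⟧ _ (s : K⟦X⟧⟦X⟧) * e = algebraMap K⟦X⟧⟦X⟧ _ h}
  zero_mem' := ⟨1, one_ne_zero, 0, zero_mem _, by simp⟩
  one_mem' := ⟨1, one_ne_zero, 1, one_mem _, by simp⟩
  add_mem' := by
    rintro e f ⟨s, hs, g, hg, he⟩ ⟨t, ht, h, hh, hf⟩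
    refine ⟨s * t, mul_ne_zero hs ht, t * g + s * h,
      add_mem (mul_mem (coe_mem_finiteRank t) hg) (mul_mem (coe_mem_finiteRank s) hh), ?_⟩
    rw [Polynomial.coe_mul, map_mul, map_add, map_mul, map_mul, ← he, ← hf]
    ring
  neg_mem' := by
    rintro e ⟨s, hs, g, hg, he⟩
    exact ⟨s, hs, -g, neg_mem hg, by rw [map_neg, ← he, mul_neg]⟩
  mul_mem' := by
    rintro e f ⟨s, hs, g, hg, he⟩ ⟨t, ht, h, hh, hf⟩
    refine ⟨s * t, mul_ne_zero hs ht, g * h, mul_mem hg hh, ?_⟩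
    rw [Polynomial.coe_mul, map_mul, map_mul, ← he, ← hf]
    ring

theorem algebraMap_mem_finiteRankFractions {h : K⟦X⟧⟦X⟧} (hh : h ∈ finiteRank K) :
    algebraMap _ _ h ∈ finiteRankFractions K :=
  ⟨1, one_ne_zero, h, hh, by simp⟩

variable (K) in
/-- The field of fractions of the polynomials in the second variable. -/
noncomputable def polynomialFractions : Subfield (FractionRing K⟦X⟧⟦X⟧) :=
  Subfield.closure (((algebraMap K⟦X⟧⟦X⟧ (FractionRing K⟦X⟧⟦X⟧)).comp
    Polynomial.coeToPowerSeries.ringHom).range : Set (FractionRing K⟦X⟧⟦X⟧))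

theorem algebraMap_coe_mem_polynomialFractions (s : Polynomial K⟦X⟧) :
    algebraMap _ _ (s : K⟦X⟧⟦X⟧) ∈ polynomialFractions K :=
  Subfield.subset_closure ⟨s, rfl⟩

/-- Every element of the field is a quotient of two polynomials, and the denominator serves as the
multiplier. -/
theorem polynomialFractions_le_finiteRankFractions :
    (polynomialFractions K).toSubring ≤ finiteRankFractions K := by
  intro e he
  obtain ⟨y, hy, z, hz, rfl⟩ := Subfield.mem_closure_iff.1 (show e ∈ polynomialFractions K from he)
  rw [Subring.closure_eq] at hy hz
  obtain ⟨s, rfl⟩ := hy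
  obtain ⟨t, rfl⟩ := hz
  by_cases ht : t = 0
  · simp [ht, zero_mem]
  · refine ⟨t, ht, s, coe_mem_finiteRank s, ?_⟩
    have : algebraMap _ (FractionRing K⟦X⟧⟦X⟧) (t : K⟦X⟧⟦X⟧) ≠ 0 := by
      rw [Ne, FaithfulSMul.algebraMap_eq_zero_iff]
      simpa using ht
    exact mul_div_cancel₀ _ this

end PowerSeries

/-! ### Solving the linear system up to a polynomial denominator. -/

open PowerSeries

open Classical in
/-- Solutions of the linear system of a grammar whose symbols on the left are evaluated to series
in the first variable and whose symbols on the right to series in the second one. -/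
theorem ContextFreeRule.exists_mul_mem_finiteRank {T ι K : Type*} [Fintype ι] [Field K]
    (rules : Finset (ContextFreeRule T ι)) (p q : Symbol T ι → K⟦X⟧) (d : Symbol T ι → K⟦X⟧⟦X⟧)
    (hpq : ∀ X, constantCoeff (p X) = constantCoeff (q X))
    (hdet : (1 - jacobian rules (constantCoeff ∘ q) (constantCoeff ∘ q)).det ≠ 0)
    (hq : ∀ A, q (.nonterminal A) = ∑ ρ ∈ rules with ρ.input = A, (ρ.output.map q).prod)
    (hd : ∀ A, d (.nonterminal A) = ∑ ρ ∈ rules with ρ.input = A,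
      leibnizSum (fun X => C (p X)) (fun X => PowerSeries.map C (q X)) d ρ.output)
    (hqt : ∀ t, ∃ s : Polynomial K, q (.terminal t) = s)
    (hdt : ∀ t, ∃ s : Polynomial K⟦X⟧, d (.terminal t) = s) (A : ι) :
    ∃ s : Polynomial K⟦X⟧, s ≠ 0 ∧ (s : K⟦X⟧⟦X⟧) * d (.nonterminal A) ∈ finiteRank K := by
  let F := FractionRing K⟦X⟧⟦X⟧
  let φ := algebraMap K⟦X⟧⟦X⟧ F
  have hφ : Function.Injective φ := FaithfulSMul.algebraMap_injective _ _
  let k := polynomialFractions K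
  -- Evaluation at the origin: by `hpq` both families of coefficients become `constantCoeff ∘ q`, so
  -- a determinant that vanished would contradict `hdet`.
  let ε : K⟦X⟧⟦X⟧ →+* K := constantCoeff.comp constantCoeff
  let pΩ : Symbol T ι → F := fun X => φ (C (p X))
  let qΩ : Symbol T ι → F := fun X => φ (PowerSeries.map C (q X))
  have hεp : (ε ∘ fun X => C (p X)) = constantCoeff ∘ q := by
    funext X; simp [ε, hpq]
  have hεq : (ε ∘ fun X => PowerSeries.map C (q X)) = constantCoeff ∘ q := by
    funext X
    change constantCoeff (constantCoeff (PowerSeries.map C (q X))) = constantCoeff (q X)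
    rw [← coeff_zero_eq_constantCoeff_apply (PowerSeries.map C (q X)), coeff_map,
      constantCoeff_C, coeff_zero_eq_constantCoeff_apply]
  have hdet_of (l r : Symbol T ι → K⟦X⟧⟦X⟧) (hl : ε ∘ l = constantCoeff ∘ q)
      (hr : ε ∘ r = constantCoeff ∘ q) : (1 - jacobian rules (φ ∘ l) (φ ∘ r)).det ≠ 0 := by
    rw [← map_det_one_sub_jacobian, Ne, map_eq_zero_iff φ hφ]
    intro h
    apply hdet
    rw [← hl]
    nth_rw 2 [hl]
    rw [← hr, ← map_det_one_sub_jacobian, h, map_zero]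
  have hqt' (t : T) : qΩ (.terminal t) ∈ k := by
    obtain ⟨s, hs⟩ := hqt t
    have : PowerSeries.map C (q (.terminal t)) = ((s.map C : Polynomial K⟦X⟧) : K⟦X⟧⟦X⟧) := by
      rw [hs]; exact (Polynomial.polynomial_map_coe).symm
    simp only [qΩ, this]
    exact algebraMap_coe_mem_polynomialFractions _
  have halg (B : ι) : IsAlgebraic k (qΩ (.nonterminal B)) := by
    refine isAlgebraic_of_eq_sum_prod rules qΩ (hdet_of _ _ hεq hεq) (fun A => ?_)
      (fun t => ⟨⟨_, hqt' t⟩, rfl⟩) B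
    simp only [qΩ, hq A, map_sum, map_list_prod, List.map_map]
    rfl
  let S : Set F := Set.range fun B => qΩ (.nonterminal B)
  let E := IntermediateField.adjoin k S
  -- Algebraicity makes division by the `qΩ` unnecessary, which matters since series of finite rank
  -- form only a ring.
  have hE : E.toSubalgebra = Algebra.adjoin k S :=
    IntermediateField.adjoin_toSubalgebra_of_isAlgebraic (by rintro _ ⟨B, rfl⟩; exact halg B)
  have hkE (x : F) (hx : x ∈ k) : x ∈ E := E.algebraMap_mem ⟨x, hx⟩
  have hpE (X : Symbol T ι) : pΩ X ∈ E := by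
    apply hkE
    have := algebraMap_coe_mem_polynomialFractions (Polynomial.C (p X))
    rwa [Polynomial.coe_C] at this
  have hqE (X : Symbol T ι) : qΩ X ∈ E := by
    cases X with
    | terminal t => exact hkE _ (hqt' t)
    | nonterminal B => exact IntermediateField.subset_adjoin k S ⟨B, rfl⟩
  let pE : Symbol T ι → E := fun X => ⟨pΩ X, hpE X⟩
  let qE : Symbol T ι → E := fun X => ⟨qΩ X, hqE X⟩
  have hdetE : (1 - jacobian rules pE qE).det ≠ 0 := by
    intro h
    have := map_det_one_sub_jacobian (algebraMap E F) rules pE qE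
    rw [h, map_zero] at this
    exact hdet_of _ _ hεp hεq this.symm
  have hsum (α : List (Symbol T ι)) : leibnizSum pE qE (fun X => φ (d X)) α =
      φ (leibnizSum (fun X => C (p X)) (fun X => PowerSeries.map C (q X)) d α) := by
    induction α with
    | nil => simp [leibnizSum]
    | cons X α ih =>
      have hprod : ((α.map qE).prod : F) = φ (α.map fun X => PowerSeries.map C (q X)).prod := by
        rw [map_list_prod, List.map_map]
        have := map_list_prod (algebraMap E F) (α.map qE)
        rw [List.map_map] at this
        exact this
      simp only [leibnizSum, ih, map_add, smul_eq_mul, map_mul, Algebra.smul_def]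
      exact congrArg₂ (· + ·) rfl (congrArg (· * φ (d X)) hprod)
  -- The subspace is `E` itself inside `F`: coefficients and terminal values lie in `E`, hence so
  -- does the solution.
  have hmem := mem_of_eq_sum_leibnizSum rules pE qE (fun X => φ (d X))
    (LinearMap.range (Algebra.linearMap E F)) hdetE
    (fun A => by simp only [hd A, map_sum, hsum])
    (fun t => by
      obtain ⟨s, hs⟩ := hdt t
      refine ⟨⟨φ (d (.terminal t)), hkE _ ?_⟩, rfl⟩
      rw [hs]
      exact algebraMap_coe_mem_polynomialFractions s) A
  obtain ⟨e, he⟩ := hmem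
  have hadj : φ (d (.nonterminal A)) ∈ Algebra.adjoin k S := by
    rw [← hE, ← he]
    exact e.2
  have hfrac : φ (d (.nonterminal A)) ∈ finiteRankFractions K := by
    generalize φ (d (.nonterminal A)) = z at hadj ⊢
    induction hadj using Algebra.adjoin_induction with
    | mem x hx =>
      obtain ⟨B, rfl⟩ := hx
      exact algebraMap_mem_finiteRankFractions (map_C_mem_finiteRank _)
    | algebraMap x => exact polynomialFractions_le_finiteRankFractions x.2
    | add x y _ _ hx hy => exact add_mem hx hy
    | mul x y _ _ hx hy => exact mul_mem hx hy
  obtain ⟨s, hs, h, hh, e⟩ := hfrac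
  refine ⟨s, hs, ?_⟩
  rwa [hφ ((map_mul φ _ _).trans e)]

/-! ### Joining forests and forests of empty yield. -/

namespace ContextFreeGrammar

open ParseForest PowerSeries ContextFreeRule

variable {T : Type*} {G : ContextFreeGrammar T}

theorem ParseForest.exists_append {α β : List (Symbol T G.NT)} (f : G.ParseForest α)
    (g : G.ParseForest β) :
    ∃ h : G.ParseForest (α ++ β), h.yield = f.yield ++ g.yield ∧ h.size = f.size + g.size := by
  induction α with
  | nil => exact ⟨g, by rw [eq_nil f]; simp [yield, size]⟩
  | cons X α ih =>
    obtain ⟨h, hy, hs⟩ := ih f.tail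
    have e : f.head.cons f.tail = f := (consEquiv X α).left_inv f
    refine ⟨f.head.cons h, ?_, ?_⟩
    · rw [yield_cons, hy, ← List.append_assoc, ← yield_cons, e]
    · rw [size_cons, hs, ← add_assoc, ← size_cons, e]

theorem ParseForest.exists_yield_nil {α : List (Symbol T G.NT)}
    (h : (α.map fun X => G.parity [X] []).prod ≠ 0) :
    ∃ f : G.ParseForest α, f.yield = [] := by
  induction α with
  | nil => exact ⟨.nil, rfl⟩
  | cons X α ih =>
    rw [List.map_cons, List.prod_cons] at h
    obtain ⟨f, hf⟩ := exists_of_parity_ne_zero (left_ne_zero_of_mul h)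
    obtain ⟨g, hg⟩ := ih (right_ne_zero_of_mul h)
    exact ⟨f.cons g, by rw [yield_cons, hf, hg]; rfl⟩

/-! ### The trimmed grammar and its Jacobian at the empty string. -/

section Trim

variable (G) in
/-- The nonterminals that have a parse tree, but no string with infinitely many of them. -/
def TrimNT : Type := {A : G.NT // G.FinitelyAmbiguous [.nonterminal A] ∧ Nonempty (G.ParseTree A)}

theorem exists_rule (A : G.NT) (f : G.ParseTree A) : ∃ r ∈ G.rules, r.input = A := by
  obtain ⟨⟨r, hr⟩, -⟩ := nodeEquiv A f
  exact ⟨r, hr⟩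

instance : Finite G.TrimNT := by
  classical
  refine Set.Finite.subset (G.rules.image (·.input)).finite_toSet fun A hA => ?_
  obtain ⟨r, hr, rfl⟩ := exists_rule A hA.2.some
  simpa using ⟨r, hr, rfl⟩

noncomputable instance : Fintype G.TrimNT := Fintype.ofFinite _

/-- Inclusion of the symbols of the trimmed grammar. -/
def untrim : Symbol T G.TrimNT → Symbol T G.NT
  | .terminal t => .terminal t
  | .nonterminal A => .nonterminal A.1

theorem untrim_injective : Function.Injective (untrim (G := G)) := by
  rintro (t | A) (t' | A') h
  · simpa [untrim] using h
  · simp [untrim] at h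
  · simp [untrim] at h
  · simp only [untrim, Symbol.nonterminal.injEq] at h
    rw [Subtype.ext h]

/-- Inclusion of the rules of the trimmed grammar. -/
def untrimRule (ρ : ContextFreeRule T G.TrimNT) : ContextFreeRule T G.NT :=
  ⟨ρ.input.1, ρ.output.map untrim⟩

theorem untrimRule_injective : Function.Injective (untrimRule (G := G)) := by
  rintro ⟨A, α⟩ ⟨B, β⟩ h
  simp only [untrimRule, ContextFreeRule.mk.injEq] at h
  rw [Subtype.ext h.1, untrim_injective.list_map h.2]

variable (G) in
/-- The rules between trimmed nonterminals whose right-hand side has a forest. -/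
noncomputable def trimRules : Finset (ContextFreeRule T G.TrimNT) :=
  ((G.rules.finite_toSet.preimage untrimRule_injective.injOn).subset
    (t := {ρ | untrimRule ρ ∈ G.rules ∧ Nonempty (G.ParseForest (ρ.output.map untrim))})
    fun _ h => h.1).toFinset

theorem mem_trimRules {ρ : ContextFreeRule T G.TrimNT} : ρ ∈ G.trimRules ↔
    untrimRule ρ ∈ G.rules ∧ Nonempty (G.ParseForest (ρ.output.map untrim)) := by
  simp [trimRules]

theorem finitelyAmbiguous_of_mem_trimRules {ρ : ContextFreeRule T G.TrimNT}
    (h : ρ ∈ G.trimRules) : G.FinitelyAmbiguous (ρ.output.map untrim) :=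
  FinitelyAmbiguous.output (mem_trimRules.1 h).1 ρ.input.2.1

open Classical in
-- A rule lost by trimming has no forest over its right-hand side and contributes zero: in any such
-- forest, every nonterminal would itself be trimmed.
theorem parity_trim (A : G.TrimNT) (w : List T) :
    G.parity [untrim (.nonterminal A)] w =
      ∑ ρ ∈ G.trimRules with ρ.input = A, G.parity (ρ.output.map untrim) w := by
  rw [untrim, parity_nonterminal A.2.1]
  symm
  refine Finset.sum_of_injOn untrimRule untrimRule_injective.injOn ?_ ?_ fun _ _ => rfl
  · intro ρ hρ
    simp only [Finset.coe_filter, Set.mem_ofPred_eq] at hρ ⊢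
    exact ⟨(mem_trimRules.1 hρ.1).1, congrArg Subtype.val hρ.2⟩
  · intro r hr hr'
    by_contra hne
    apply hr'
    obtain ⟨f, -⟩ := exists_of_parity_ne_zero hne
    rw [Finset.mem_filter] at hr
    obtain ⟨hr, hrA⟩ := hr
    obtain ⟨A₀, α⟩ := r
    dsimp only at hrA f
    subst hrA
    have hα : α ∈ Set.range (List.map (untrim (G := G))) := by
      rw [Set.range_list_map]
      intro X hX
      have hfin : G.FinitelyAmbiguous α := FinitelyAmbiguous.output hr A.2.1
      cases X with
      | terminal t => exact ⟨.terminal t, rfl⟩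
      | nonterminal B => exact ⟨.nonterminal ⟨B, hfin.symbol f hX⟩, rfl⟩
    obtain ⟨β, rfl⟩ := hα
    exact ⟨⟨A, β⟩, by simpa using mem_trimRules.2 ⟨hr, ⟨f⟩⟩, rfl⟩

/-- Among the trees of a trimmed nonterminal whose yields belong to a finite set there is a
largest one. -/
theorem exists_max_size (W : Set (List T)) (hW : W.Finite) (A : G.TrimNT)
    (hA : ∃ t : G.ParseTree A.1, t.yield ∈ W) :
    ∃ t : G.ParseTree A.1, t.yield ∈ W ∧ ∀ t' : G.ParseTree A.1, t'.yield ∈ W →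
      t'.size ≤ t.size := by
  have hfin : {t : G.ParseTree A.1 | t.yield ∈ W}.Finite := by
    have : {t : G.ParseTree A.1 | t.yield ∈ W} = ⋃ w ∈ W, G.parseTrees A.1 w := by
      ext t
      simp [parseTrees]
    rw [this]
    exact hW.biUnion fun w _ => A.2.1 w
  obtain ⟨t, ht, hmax⟩ := Set.exists_max_image _ size hfin hA
  exact ⟨t, ht, hmax⟩

open Classical in
-- A nonzero entry at `(A, B)` gives a rule `A → βBγ` where `β` and `γ` yield the empty string.
-- Wrapping a tree of `B` in it keeps the yield and increases the size, so the maximal size is a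
-- rank function.
theorem det_one_sub_jacobian_trimRules_ne_zero :
    (1 - jacobian G.trimRules (fun X => G.parity [untrim X] [])
      (fun X => G.parity [untrim X] [])).det ≠ 0 := by
  -- One yield per nonterminal: a finite set, common to all nonterminals, in which each has a tree.
  let W : Set (List T) := Set.range fun A : G.TrimNT => A.2.2.some.yield
  have hmax (A : G.TrimNT) := exists_max_size W (Set.finite_range _) A ⟨A.2.2.some, A, rfl⟩
  choose t ht hmax using hmax
  refine Matrix.det_one_sub_ne_zero_of_rank _ (fun A => (t A).size) fun A B hAB => ?_
  obtain ⟨ρ, hρ, hne⟩ := Finset.exists_ne_zero_of_sum_ne_zero hAB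
  obtain ⟨β, γ, he, hβ, hγ⟩ := exists_of_leibnizSum_indicator_ne_zero hne
  rw [Finset.mem_filter] at hρ
  obtain ⟨hρ, rfl⟩ := hρ
  obtain ⟨f, hf⟩ := exists_yield_nil (G := G) (α := β.map untrim) (by rwa [List.map_map])
  obtain ⟨g, hg⟩ := exists_yield_nil (G := G) (α := γ.map untrim) (by rwa [List.map_map])
  obtain ⟨h, hy, hs⟩ := f.exists_append ((t B).cons g)
  have hout : ρ.output.map untrim =
      β.map untrim ++ (.nonterminal B.1 :: γ.map untrim) := by
    rw [he]; simp [untrim]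
  have hrule : ContextFreeRule.mk ρ.input.1
      (β.map untrim ++ (.nonterminal B.1 :: γ.map untrim)) ∈ G.rules := by
    rw [← hout]; exact (mem_trimRules.1 hρ).1
  have hlt := hmax ρ.input (.node _ _ hrule h .nil) (by
    simpa [yield, hy, yield_cons, hf, hg] using ht B)
  simp only [size, hs, size_cons] at hlt
  omega

end Trim

/-! ### Generating series on `a*` and `a* b*`. -/

section Series

variable (a b : T)

/-- The series of the parities at the powers of one letter. -/
noncomputable def unarySeries (α : List (Symbol T G.NT)) : (ZMod 2)⟦X⟧ :=
  .mk fun i => G.parity α (List.replicate i a)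

/-- The series of the parities at the strings of the form `aⁱ bʲ`. -/
noncomputable def binarySeries (α : List (Symbol T G.NT)) : (ZMod 2)⟦X⟧⟦X⟧ :=
  .mk fun j => .mk fun i => G.parity α (List.replicate i a ++ List.replicate j b)

theorem unarySeries_cons {X : Symbol T G.NT} {α : List (Symbol T G.NT)}
    (h : G.FinitelyAmbiguous (X :: α)) :
    unarySeries a (X :: α) = unarySeries a [X] * unarySeries a α := by
  ext i
  simp only [unarySeries, coeff_mk, coeff_mul, parity_cons h, List.cauchyProd_replicate]

theorem binarySeries_cons {X : Symbol T G.NT} {α : List (Symbol T G.NT)}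
    (h : G.FinitelyAmbiguous (X :: α)) :
    binarySeries a b (X :: α) = C (unarySeries a [X]) * binarySeries a b α +
      binarySeries a b [X] * PowerSeries.map C (unarySeries b α) -
      C (unarySeries a [X]) * PowerSeries.map C (unarySeries b α) := by
  ext j i
  simp only [map_add, map_sub, coeff_C_mul, coeff_map]
  rw [coeff_mul j, map_sum]
  simp only [coeff_map, coeff_mul_C]
  simp only [coeff_mul, unarySeries, binarySeries, coeff_mk, parity_cons h,
    List.cauchyProd_replicate_append]

/-- The forest `f` supplies the padding that passes finite ambiguity on to the tail. -/
theorem unarySeries_eq_prod {α : List (Symbol T G.NT)} (h : G.FinitelyAmbiguous α)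
    (f : G.ParseForest α) :
    unarySeries a α = (α.map fun X => unarySeries a [X]).prod := by
  classical
  induction α with
  | nil =>
    ext i
    simp [unarySeries, parity_nil, coeff_one, List.replicate_eq_nil_iff]
  | cons X α ih =>
    rw [unarySeries_cons a h, List.map_cons, List.prod_cons, ih (h.tail f.head) f.tail]

/-- Subtracting the part without `b` absorbs the correction for the doubly counted cut in
`binarySeries_cons` and leaves an exact twisted Leibniz rule. -/
theorem binarySeries_sub_eq_leibnizSum {α : List (Symbol T G.NT)} (h : G.FinitelyAmbiguous α)
    (f : G.ParseForest α) :
    binarySeries a b α - C (unarySeries a α) =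
      leibnizSum (fun X => C (unarySeries a [X])) (fun X => PowerSeries.map C (unarySeries b [X]))
        (fun X => binarySeries a b [X] - C (unarySeries a [X])) α := by
  classical
  induction α with
  | nil =>
    ext j i
    simp only [leibnizSum, binarySeries, unarySeries, map_sub, coeff_mk, parity_nil, coeff_C]
    by_cases hj : j = 0 <;> simp [hj]
  | cons X α ih =>
    rw [leibnizSum, ← ih (h.tail f.head) f.tail, binarySeries_cons a b h, unarySeries_cons a h,
      unarySeries_eq_prod b (h.tail f.head) f.tail]
    simp only [smul_eq_mul, map_mul, map_list_prod, List.map_map, Function.comp_def]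
    ring

theorem exists_unarySeries_terminal (t : T) :
    ∃ s : Polynomial (ZMod 2), unarySeries (G := G) b [.terminal t] = s := by
  classical
  by_cases h : b = t
  · refine ⟨Polynomial.X, ?_⟩
    ext i
    simp only [unarySeries, coeff_mk, parity_terminal, Polynomial.coe_X, coeff_X]
    congr 1
    rw [show [t] = List.replicate 1 t from rfl, List.replicate_inj]
    simp [h]
  · refine ⟨0, ?_⟩
    ext i
    simp only [unarySeries, coeff_mk, parity_terminal, Polynomial.coe_zero, map_zero]
    rw [if_neg]
    rw [show [t] = List.replicate 1 t from rfl, List.replicate_inj]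
    simp [h]
    omega

theorem exists_binarySeries_terminal (t : T) :
    ∃ s : Polynomial (ZMod 2)⟦X⟧, binarySeries (G := G) a b [.terminal t] -
      C (unarySeries (G := G) a [.terminal t]) = s := by
  classical
  -- The coefficient at `j = 0` cancels against the subtracted series, and for `j ≥ 2` the string is
  -- longer than `[t]`; only `j = 1` remains.
  refine ⟨Polynomial.C (coeff 1 (binarySeries (G := G) a b [.terminal t])) * Polynomial.X, ?_⟩
  rw [Polynomial.coe_mul, Polynomial.coe_C, Polynomial.coe_X]
  ext j i
  rcases j with _ | _ | j
  · simp [binarySeries, unarySeries]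
  · simp [coeff_C, coeff_succ_mul_X, -PowerSeries.coeff_zero_eq_constantCoeff]
  · have : List.replicate i a ++ List.replicate (j + 1 + 1) b ≠ [t] := fun h => by
      have := congrArg List.length h
      simp at this
      omega
    simp [binarySeries, parity_terminal, this]

open Classical in
/-- Over `a* b*`, the parities of the trees of a nonterminal form a quotient of a series of finite
rank by a polynomial. -/
theorem exists_mul_binarySeries_mem_finiteRank (A : G.TrimNT) :
    ∃ s : Polynomial (ZMod 2)⟦X⟧, s ≠ 0 ∧
      (s : (ZMod 2)⟦X⟧⟦X⟧) * (binarySeries a b [.nonterminal A.1] -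
        C (unarySeries a [.nonterminal A.1])) ∈ finiteRank (ZMod 2) := by
  refine ContextFreeRule.exists_mul_mem_finiteRank G.trimRules
    (fun X => unarySeries a [untrim X]) (fun X => unarySeries b [untrim X])
    (fun X => binarySeries a b [untrim X] - C (unarySeries a [untrim X]))
    (fun X => by simp [unarySeries, ← coeff_zero_eq_constantCoeff_apply,
      -coeff_zero_eq_constantCoeff]) ?_ (fun A => ?_)
    (fun A => ?_) (fun t => exists_unarySeries_terminal b t)
    (fun t => exists_binarySeries_terminal a b t) A
  · have e : (constantCoeff ∘ fun X => unarySeries b [untrim X]) =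
        fun X => G.parity [untrim X] [] := by
      funext X
      simp [unarySeries, ← coeff_zero_eq_constantCoeff_apply, -coeff_zero_eq_constantCoeff]
    rw [e]
    exact det_one_sub_jacobian_trimRules_ne_zero
  · have : unarySeries b [untrim (.nonterminal A)] =
        ∑ ρ ∈ G.trimRules with ρ.input = A, unarySeries b (ρ.output.map untrim) := by
      ext i
      simp [unarySeries, parity_trim]
    rw [this]
    refine Finset.sum_congr rfl fun ρ hρ => ?_
    have hρ := (Finset.mem_filter.1 hρ).1
    rw [unarySeries_eq_prod b (finitelyAmbiguous_of_mem_trimRules hρ) (mem_trimRules.1 hρ).2.some,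
      List.map_map]
    rfl
  · have : binarySeries a b [untrim (.nonterminal A)] -
        C (unarySeries a [untrim (.nonterminal A)]) =
        ∑ ρ ∈ G.trimRules with ρ.input = A,
          (binarySeries a b (ρ.output.map untrim) - C (unarySeries a (ρ.output.map untrim))) := by
      rw [Finset.sum_sub_distrib, ← map_sum]
      congr 1
      · ext j i
        simp [binarySeries, parity_trim]
      · congr 1
        ext i
        simp [unarySeries, parity_trim]
    rw [this]
    refine Finset.sum_congr rfl fun ρ hρ => ?_
    have hρ := (Finset.mem_filter.1 hρ).1
    rw [binarySeries_sub_eq_leibnizSum a b (finitelyAmbiguous_of_mem_trimRules hρ)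
      (mem_trimRules.1 hρ).2.some, leibnizSum_map]
    rfl

end Series

end ContextFreeGrammar

/-! ### The contradiction for the given language. -/

open ContextFreeGrammar PowerSeries in
theorem theorem3p3 {T : Type*} (a b : T) (hab : a ≠ b) :
    ¬ Language.IsGF2
      ({w | ∃ n : ℕ, w = List.replicate (2 ^ n) a ++ List.replicate (2 ^ n) b} : Language T) := by
  classical
  rintro ⟨G, hG⟩
  have hpar (i j : ℕ) :
      G.parity [.nonterminal G.initial] (List.replicate i a ++ List.replicate j b) =
        if ∃ n, i = 2 ^ n ∧ j = 2 ^ n then 1 else 0 := by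
    have hmem : List.replicate i a ++ List.replicate j b ∈ G.language ↔
        ∃ n, i = 2 ^ n ∧ j = 2 ^ n := by
      rw [hG]
      refine exists_congr fun n => ⟨fun h => ?_, fun h => by rw [h.1, h.2]⟩
      have ha := congrArg (List.count a) h
      have hb := congrArg (List.count b) h
      simp [List.count_replicate, hab, hab.symm] at ha hb
      exact ⟨ha, hb⟩
    have hodd : G.parity [.nonterminal G.initial] (List.replicate i a ++ List.replicate j b) = 1 ↔
        List.replicate i a ++ List.replicate j b ∈ G.language :=
      ZMod.natCast_eq_one_iff_odd
    rw [← hmem]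
    split_ifs with h
    · exact hodd.2 h
    · have := mt hodd.1 h
      generalize G.parity _ _ = z at this
      revert z
      decide
  -- The string `ab`, the case `n = 0`, has a tree, so the initial symbol survives trimming.
  have hS : Nonempty (G.ParseTree G.initial) := by
    obtain ⟨f, -⟩ := exists_of_parity_ne_zero (G := G.toContextFreeGrammar)
      (by rw [hpar 1 1, if_pos ⟨0, rfl, rfl⟩]; exact one_ne_zero)
    exact ⟨f⟩
  obtain ⟨s, hs, hmem⟩ := exists_mul_binarySeries_mem_finiteRank (G := G.toContextFreeGrammar) a b
    ⟨G.initial, G.finite_parseTrees, hS⟩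
  -- Zero is not a power of two, so no `aⁱ` is in the language and the subtracted part vanishes.
  have hunary : unarySeries a [.nonterminal G.initial] = 0 := by
    ext i
    have := hpar i 0
    rw [if_neg (by rintro ⟨n, -, h⟩; exact (Nat.two_pow_pos n).ne h)] at this
    simpa [unarySeries] using this
  rw [hunary, map_zero, sub_zero] at hmem
  refine mul_notMem_finiteRank (fun n => ?_) (fun j hj => ?_) hs hmem
  · ext i
    simp only [binarySeries, coeff_mk, hpar, coeff_X_pow]
    congr 1
    refine propext ⟨?_, fun h => ⟨n, h, rfl⟩⟩
    rintro ⟨m, rfl, h⟩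
    exact h.symm
  · ext i
    simp only [binarySeries, coeff_mk, hpar, map_zero]
    rw [if_neg]
    rintro ⟨n, -, h⟩
    exact hj n h
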